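/- Let $Y_1,Y_2,\ldots$ be independent random variables with values in $\{0,1\}$ and constant success probability $\mathbb P(Y_\ell=1)=p\in(0,1)$ for all $\ell\ge 1$ (the null hypothesis $H_0$). Let $d\ge 3$ be an integer, $q=\lfloor (d-1)/2\rfloor$, and for $1\le i\le d$ and $n\ge d$ put $$Z_i^n=\frac1{\lfloor n/d\rfloor}\sum_{k=0}^{\lfloor n/d\rfloor-1}Y_{i+kd}.$$ For $x=(x_1,\ldots,x_d)\in\mathbb R^d$ and $1\le j\le q$ let $$I_x(\omega_j)=\frac1d\Bigl|\sum_{\ell=1}^d x_\ell e^{-\mathrm i\ell\omega_j}\Bigr|^2,\qquad \omega_j=\frac{2\pi j}{d},$$ let $A=\{x\in\mathbb R^d : I_x(\omega_1)=\cdots=I_x(\omega_q)=0\}$, and let $$g(x)=\frac{\max_{1\le j\le q}I_x(\omega_j)}{\sum_{m=1}^q I_x(\omega_m)}\quad (x\notin A),\qquad f(x)=\begin{cases} g(x), & x\notin A,\\ 0, & x\in A.\end{cases}$$ (a) If $N_1,\ldots,N_d$ are i.i.d. standard normal random variables, then $(N_1,\ldots,N_d)\notin A$ almost surely, and, as $n\to\infty$,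 $$f(Z_1^n,\ldots,Z_d^n)\longrightarrow g(N_1,\ldots,N_d)\quad\text{in law}.$$ (b) Let $\alpha\in(0,1)$ and consider the equation $$\sum_{j=1}^q(-1)^{j+1}\binom qj(1-jk)_+^{q-1}=\alpha,\qquad k\in\mathbb R,$$ where $x_+=\max\{x,0\}$ and $0^0=1$. If $d\ge5$ (that is, $q\ge2$), it has exactly one solution. Whenever $k_\alpha$ is a solution, the test that rejects $H_0$ when $f(Z_1^n,\ldots,Z_d^n)>k_\alpha$ has asymptotic level $\alpha$ under $H_0$: $$\lim_{n\to\infty}\mathbb P\bigl(f(Z_1^n,\ldots,Z_d^n)>k_\alpha\bigr)=\alpha .$$ -/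

import Mathlib

open MeasureTheory ProbabilityTheory Filter Topology

namespace BinaryPeriodicity

/- Indexing: the observation `Y ℓ` (`ℓ : ℕ`, from `0`) is the `(ℓ + 1)`-st one, and a time series
`x : Fin d → ℝ` lists its `d` entries from `0`, so `x ℓ` is the `(ℓ + 1)`-st entry. The Fourier
frequencies keep their usual indices `1, …, q`. -/

/-- The number `q = ⌊(d - 1) / 2⌋` of Fourier frequencies in use (meant for `d ≥ 1`). -/
def numFreq (d : ℕ) : ℕ := (d - 1) / 2

/-- The `j`-th Fourier frequency `ω_j = 2πj / d` of a time series of length `d`. -/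
noncomputable def fourierFreq (d j : ℕ) : ℝ := 2 * Real.pi * j / d

/-- The periodogram `I_x(ω_j) = (1/d) |∑_{ℓ=1}^d x_ℓ exp(-i ℓ ω_j)|²`. -/
noncomputable def periodogram {d : ℕ} (x : Fin d → ℝ) (j : ℕ) : ℝ :=
  (1 / d : ℝ) *
    ‖∑ ℓ : Fin d, (x ℓ : ℂ) *
      Complex.exp (-Complex.I * (((ℓ : ℕ) + 1 : ℕ) : ℂ) * (fourierFreq d j : ℂ))‖ ^ 2

/-- The set `A` of time series all of whose periodograms at `ω_1, …, ω_q` vanish. -/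
def degenerateSet (d : ℕ) : Set (Fin d → ℝ) :=
  {x | ∀ j ∈ Finset.Icc 1 (numFreq d), periodogram x j = 0}

/-- Fisher's `g`: the largest of the periodograms at `ω_1, …, ω_q` divided by their sum. It is
meaningful outside `degenerateSet d`. -/
noncomputable def fisherG {d : ℕ} (x : Fin d → ℝ) : ℝ :=
  (⨆ j : Finset.Icc 1 (numFreq d), periodogram x j) /
    ∑ m ∈ Finset.Icc 1 (numFreq d), periodogram x m

/-- The function `f`, equal to Fisher's `g` outside `A` and to `0` on `A`. -/
noncomputable def fisherF {d : ℕ} (x : Fin d → ℝ) : ℝ :=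
  (degenerateSet d)ᶜ.indicator fisherG x

/-- The transformed time series `Z_i^n = ⌊n/d⌋⁻¹ ∑_{k=0}^{⌊n/d⌋-1} Y_{i+kd}`, `1 ≤ i ≤ d`. -/
noncomputable def blockMean {Ω : Type*} (Y : ℕ → Ω → ℝ) (d n : ℕ) (ω : Ω) : Fin d → ℝ :=
  fun i => (1 / ((n / d : ℕ) : ℝ)) * ∑ k ∈ Finset.range (n / d), Y ((i : ℕ) + k * d) ω

/-- The function `x ↦ ∑_{j=1}^q (-1)^{j+1} C(q,j) (1 - jx)_+^{q-1}`. -/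
noncomputable def fisherTail (q : ℕ) (x : ℝ) : ℝ :=
  ∑ j ∈ Finset.Icc 1 q, (-1 : ℝ) ^ (j + 1) * (q.choose j : ℝ) * (max (1 - j * x) 0) ^ (q - 1)

end BinaryPeriodicity

namespace BinaryPeriodicity

/-! The statistic is a ratio of periodograms at nonzero Fourier frequencies, so it does not change
when the series is shifted by a constant or rescaled. Block means can therefore be replaced by
standardized block sums (`fisherF_blockMean`). The coordinates of these are independent, since they
use different residue classes mod `d`, and each obeys the central limit theorem; hence the vector
converges to a standard normal one (`tendsto_map_blockSum`). Fisher's `g` is continuous off the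
closed set `A`, which is null in the limit, and continuous mapping gives (a).

For (b), the cosine and sine vectors at the frequencies `1, …, q` are orthonormal up to scaling, so
the periodograms of a standard normal vector are i.i.d. standard exponential
(`map_periodogram_stdNormal`). Inclusion-exclusion over the coordinates exceeding `k` times the
total then gives Fisher's formula (`measureReal_exists_mul_sum_lt`): the tail of the limit law is
`fisherTail q` on `k ≥ 0`. Its derivative is expressed through the tail for `q - 1`, and induction
on `q` shows that it equals `1` up to `1/q` and then decreases strictly to `0` at `1`. This gives
the unique solution. The tail is continuous, so the limit law has no atom at the solution, and weak
convergence yields the asymptotic level. -/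

/-! ### Gaussian vectors of the plane in polar coordinates. -/

lemma expMeasure_one_eq_withDensity :
    expMeasure 1 = (volume.restrict (Set.Ioi 0)).withDensity
      fun t => ENNReal.ofReal (Real.exp (-t)) := by
  have h : (volume.restrict (Set.Ioi (0 : ℝ))) = volume.restrict (Set.Ici 0) :=
    Measure.restrict_congr_set Ioi_ae_eq_Ici
  rw [h, ← withDensity_indicator measurableSet_Ici]
  change volume.withDensity (exponentialPDF 1) = _
  congr 1
  ext t
  by_cases ht : 0 ≤ t
  · simp [exponentialPDF_eq, ht]
  · simp [exponentialPDF_eq, ht]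

/-- Half the squared norm of a standard normal vector of the plane is exponentially distributed. -/
lemma map_half_sq_add_sq_gaussian :
    ((gaussianReal 0 1).prod (gaussianReal 0 1)).map (fun p : ℝ × ℝ => (p.1 ^ 2 + p.2 ^ 2) / 2) =
      expMeasure 1 := by
  have hm : Measurable (fun p : ℝ × ℝ => (p.1 ^ 2 + p.2 ^ 2) / 2) := by fun_prop
  have hprod : (gaussianReal 0 1).prod (gaussianReal 0 1) =
      (volume : Measure (ℝ × ℝ)).withDensity fun p =>
        ENNReal.ofReal ((2 * Real.pi)⁻¹ * Real.exp (-((p.1 ^ 2 + p.2 ^ 2) / 2))) := by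
    rw [gaussianReal_of_var_ne_zero _ one_ne_zero,
      prod_withDensity (measurable_gaussianPDF _ _) (measurable_gaussianPDF _ _)]
    congr 1
    ext p
    simp only [gaussianPDF, gaussianPDFReal]
    rw [← ENNReal.ofReal_mul (by positivity)]
    congr 1
    have h2 : (√(2 * Real.pi))⁻¹ * (√(2 * Real.pi))⁻¹ = (2 * Real.pi)⁻¹ := by
      rw [← mul_inv, Real.mul_self_sqrt (by positivity)]
    simp only [NNReal.coe_one, mul_one, sub_zero]
    rw [mul_mul_mul_comm, h2, ← Real.exp_add]
    congr 2
    ring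
  ext s hs
  rw [Measure.map_apply hm hs, hprod, withDensity_apply _ (hm hs),
    expMeasure_one_eq_withDensity, withDensity_apply _ hs, ← lintegral_indicator (hm hs),
    ← lintegral_comp_polarCoord_symm]
  have hformula : ∀ p : ℝ × ℝ, ENNReal.ofReal p.1 •
      ((fun p : ℝ × ℝ => (p.1 ^ 2 + p.2 ^ 2) / 2) ⁻¹' s).indicator
        (fun p : ℝ × ℝ => ENNReal.ofReal ((2 * Real.pi)⁻¹ * Real.exp (-((p.1 ^ 2 + p.2 ^ 2) / 2))))
        (polarCoord.symm p) =
      (ENNReal.ofReal p.1 * s.indicator (fun t => ENNReal.ofReal (Real.exp (-t))) (p.1 ^ 2 / 2)) *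
        ENNReal.ofReal (2 * Real.pi)⁻¹ := by
    intro p
    have hp : ((polarCoord.symm p).1 ^ 2 + (polarCoord.symm p).2 ^ 2) / 2 = p.1 ^ 2 / 2 := by
      simp only [polarCoord_symm_apply, mul_pow]
      rw [← mul_add, Real.cos_sq_add_sin_sq, mul_one]
    have hind : ((fun p : ℝ × ℝ => (p.1 ^ 2 + p.2 ^ 2) / 2) ⁻¹' s).indicator
        (fun p : ℝ × ℝ => ENNReal.ofReal ((2 * Real.pi)⁻¹ * Real.exp (-((p.1 ^ 2 + p.2 ^ 2) / 2))))
        (polarCoord.symm p) = s.indicator (fun t => ENNReal.ofReal ((2 * Real.pi)⁻¹ * Real.exp (-t)))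
          (p.1 ^ 2 / 2) := by
      rw [← hp]; rfl
    rw [hind, smul_eq_mul, mul_assoc]
    congr 1
    by_cases h : p.1 ^ 2 / 2 ∈ s
    · rw [Set.indicator_of_mem h, Set.indicator_of_mem h, mul_comm, ENNReal.ofReal_mul (by positivity)]
    · simp [h]
  simp_rw [hformula]
  have htarget : (volume : Measure (ℝ × ℝ)).restrict polarCoord.target =
      (volume.restrict (Set.Ioi (0 : ℝ))).prod (volume.restrict (Set.Ioo (-Real.pi) Real.pi)) := by
    rw [Measure.prod_restrict]; rfl
  have hmeas : Measurable (fun r : ℝ =>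
      ENNReal.ofReal r * s.indicator (fun t => ENNReal.ofReal (Real.exp (-t))) (r ^ 2 / 2)) := by
    have : Measurable (s.indicator fun t => ENNReal.ofReal (Real.exp (-t))) :=
      Measurable.indicator (by fun_prop) hs
    fun_prop
  rw [htarget, lintegral_prod_mul (f := fun r : ℝ =>
      ENNReal.ofReal r * s.indicator (fun t => ENNReal.ofReal (Real.exp (-t))) (r ^ 2 / 2))
      (g := fun _ => ENNReal.ofReal (2 * Real.pi)⁻¹) hmeas.aemeasurable aemeasurable_const]
  -- The substitution `t = r ^ 2 / 2` has derivative `r`, which is exactly the polar Jacobian.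
  have himage : (fun r : ℝ => r ^ 2 / 2) '' Set.Ioi 0 = Set.Ioi 0 := by
    ext t
    constructor
    · rintro ⟨r, hr, rfl⟩
      have : 0 < r := hr
      simp only [Set.mem_Ioi]; positivity
    · intro ht
      have ht : 0 < t := ht
      refine ⟨√(2 * t), Real.sqrt_pos.2 (by positivity), ?_⟩
      simp only
      rw [Real.sq_sqrt (by positivity)]; ring
  have hcv := lintegral_image_eq_lintegral_abs_deriv_mul (s := Set.Ioi (0 : ℝ))
    (f := fun r : ℝ => r ^ 2 / 2) (f' := fun r => r) measurableSet_Ioi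
    (fun r _ => by
      have := ((hasDerivAt_pow 2 r).div_const 2).hasDerivWithinAt (s := Set.Ioi 0)
      have h2 : (2 : ℕ) * r ^ (2 - 1) / 2 = r := by norm_num
      rw [h2] at this
      exact this)
    (fun a ha b hb hab => by
      have ha : 0 < a := ha
      have hb : 0 < b := hb
      simp only at hab
      nlinarith [sq_nonneg (a - b)])
    (s.indicator (fun t => ENNReal.ofReal (Real.exp (-t))))
  rw [himage] at hcv
  have habs : ∫⁻ r in Set.Ioi (0 : ℝ), ENNReal.ofReal r *
        s.indicator (fun t => ENNReal.ofReal (Real.exp (-t))) (r ^ 2 / 2) =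
      ∫⁻ r in Set.Ioi (0 : ℝ), ENNReal.ofReal |r| *
        s.indicator (fun t => ENNReal.ofReal (Real.exp (-t))) (r ^ 2 / 2) := by
    refine setLIntegral_congr_fun measurableSet_Ioi fun r hr => ?_
    simp only [abs_of_pos (Set.mem_Ioi.1 hr)]
  rw [habs, ← hcv, lintegral_indicator hs]
  have hang : ∫⁻ _ in Set.Ioo (-Real.pi) Real.pi, ENNReal.ofReal (2 * Real.pi)⁻¹ = 1 := by
    rw [setLIntegral_const, Real.volume_Ioo, ← ENNReal.ofReal_mul (by positivity)]
    rw [show (2 * Real.pi)⁻¹ * (Real.pi - -Real.pi) = 1 by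
      have := Real.pi_ne_zero
      field_simp; ring]
    simp
  rw [hang, mul_one]

instance isProbabilityMeasure_expMeasure_one : IsProbabilityMeasure (expMeasure 1) :=
  isProbabilityMeasure_expMeasure one_pos

/-! ### Fisher's formula for i.i.d. exponential variables. -/

section Exponential

variable {ι : Type*} [Fintype ι]

/-- The joint density depends on the coordinate sum alone, so a linear map that rescales the sum
transforms it explicitly. -/
lemma pi_expMeasure_one_eq_withDensity :
    Measure.pi (fun _ : ι => expMeasure 1) =
      (volume.restrict (Set.univ.pi fun _ : ι => Set.Ioi (0 : ℝ))).withDensity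
        fun x => ENNReal.ofReal (Real.exp (-∑ i, x i)) := by
  refine Measure.pi_eq fun s hs => ?_
  have hexp : ∀ t : Set ℝ, Integrable (fun x : ℝ => Real.exp (-x))
      ((volume.restrict (Set.Ioi 0)).restrict t) := fun t =>
    (integrableOn_exp_neg_Ioi 0 : IntegrableOn _ _ _).integrable.restrict
  rw [withDensity_apply _ (MeasurableSet.univ_pi hs), volume_pi, Measure.restrict_pi_pi,
    Measure.restrict_pi_pi]
  simp_rw [← Finset.sum_neg_distrib, Real.exp_sum]
  rw [← ofReal_integral_eq_lintegral_ofReal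
      (Integrable.fintype_prod (f := fun _ x => Real.exp (-x)) fun i => hexp (s i))
      (Eventually.of_forall fun x => Finset.prod_nonneg fun i _ => (Real.exp_pos _).le),
    integral_fintype_prod_eq_prod (fun _ x => Real.exp (-x)),
    ENNReal.ofReal_prod_of_nonneg fun i _ => integral_nonneg fun x => (Real.exp_pos _).le]
  refine Finset.prod_congr rfl fun i _ => ?_
  rw [expMeasure_one_eq_withDensity, withDensity_apply _ (hs i),
    ofReal_integral_eq_lintegral_ofReal (hexp _) (Eventually.of_forall fun x => (Real.exp_pos _).le)]

lemma ae_pos_pi_expMeasure_one :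
    ∀ᵐ x ∂Measure.pi (fun _ : ι => expMeasure 1), ∀ i, 0 < x i := by
  rw [pi_expMeasure_one_eq_withDensity]
  refine (withDensity_absolutelyContinuous _ _).ae_le ?_
  filter_upwards [ae_restrict_mem (MeasurableSet.univ_pi fun _ => measurableSet_Ioi)] with x hx i
  exact hx i (Set.mem_univ i)

lemma measureReal_pi_expMeasure_one {s : Set (ι → ℝ)} (hs : MeasurableSet s) :
    (Measure.pi (fun _ : ι => expMeasure 1)).real s =
      ∫ x in s ∩ Set.univ.pi fun _ : ι => Set.Ioi (0 : ℝ), Real.exp (-∑ i, x i) := by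
  rw [integral_eq_lintegral_of_nonneg_ae (Eventually.of_forall fun x => (Real.exp_pos _).le)
    (by fun_prop), measureReal_def, pi_expMeasure_one_eq_withDensity, withDensity_apply _ hs,
    Measure.restrict_restrict hs]

/-- The linear map `y ↦ y + c (∑ y) 1_J`. -/
noncomputable def addSumOn [DecidableEq ι] (J : Finset ι) (c : ℝ) : (ι → ℝ) →L[ℝ] (ι → ℝ) :=
  (Matrix.toLin' (1 + Matrix.replicateCol Unit (fun i => if i ∈ J then c else 0) *
    Matrix.replicateRow Unit (fun _ : ι => (1 : ℝ)))).toContinuousLinearMap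

lemma addSumOn_apply [DecidableEq ι] (J : Finset ι) (c : ℝ) (y : ι → ℝ) (i : ι) :
    addSumOn J c y i = y i + if i ∈ J then c * ∑ l, y l else 0 := by
  rw [addSumOn, LinearMap.coe_toContinuousLinearMap', Matrix.toLin'_apply, Matrix.add_mulVec,
    Matrix.one_mulVec, Pi.add_apply]
  simp only [Matrix.mulVec, dotProduct, Matrix.mul_apply, Matrix.replicateCol_apply,
    Matrix.replicateRow_apply]
  split_ifs with h <;> simp [Finset.mul_sum]

/-- A rank-one perturbation of the identity: this is the matrix determinant lemma. -/
lemma det_addSumOn [DecidableEq ι] (J : Finset ι) (c : ℝ) : (addSumOn J c).det = 1 + J.card * c := by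
  rw [addSumOn, LinearMap.det_toContinuousLinearMap, LinearMap.det_toLin',
    Matrix.det_one_add_replicateCol_mul_replicateRow]
  simp [dotProduct]

lemma sum_addSumOn [DecidableEq ι] (J : Finset ι) (c : ℝ) (y : ι → ℝ) :
    ∑ i, addSumOn J c y i = (1 + J.card * c) * ∑ i, y i := by
  simp only [addSumOn_apply, Finset.sum_add_distrib, Finset.sum_ite_mem, Finset.univ_inter,
    Finset.sum_const, nsmul_eq_mul]
  ring

lemma setIntegral_exp_neg_mul_sum {b : ℝ} (hb : 0 < b) :
    ∫ x in Set.univ.pi fun _ : ι => Set.Ioi (0 : ℝ), Real.exp (-(b * ∑ i, x i)) =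
      (b⁻¹) ^ Fintype.card ι := by
  rw [volume_pi, Measure.restrict_pi_pi]
  simp_rw [Finset.mul_sum, ← Finset.sum_neg_distrib, Real.exp_sum]
  rw [integral_fintype_prod_eq_prod (fun _ x => Real.exp (-(b * x)))]
  simp_rw [← neg_mul]
  simp only [integral_exp_mul_Ioi (neg_neg_of_pos hb), Finset.prod_const, Finset.card_univ]
  congr 1
  simp [neg_div_neg_eq]

/-- For i.i.d. standard exponential variables, the probability that all variables with index in
`J` exceed the `k`-th part of the total sum. -/
lemma measureReal_forall_mul_sum_lt (hι : 2 ≤ Fintype.card ι) {k : ℝ} (hk : 0 ≤ k) (J : Finset ι) :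
    (Measure.pi (fun _ : ι => expMeasure 1)).real {x | ∀ i ∈ J, k * ∑ l, x l < x i} =
      (max (1 - J.card * k) 0) ^ (Fintype.card ι - 1) := by
  classical
  have hms : MeasurableSet {x : ι → ℝ | ∀ i ∈ J, k * ∑ l, x l < x i} := by
    have : {x : ι → ℝ | ∀ i ∈ J, k * ∑ l, x l < x i} = ⋂ i ∈ J, {x | k * ∑ l, x l < x i} := by
      ext; simp
    rw [this]
    exact J.measurableSet_biInter fun i _ => measurableSet_lt (by fun_prop) (by fun_prop)
  rcases le_or_gt (1 - J.card * k) 0 with h | h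
  -- Summing the inequalities over `J` would give a part of the total larger than the total. The
  -- exponent is positive because there are at least two variables.
  · rw [max_eq_right h, zero_pow (by omega), measureReal_def, measure_eq_zero_iff_ae_notMem.2,
      ENNReal.toReal_zero]
    filter_upwards [ae_pos_pi_expMeasure_one (ι := ι)] with x hx hmem
    have hJ : J.Nonempty := by
      by_contra hJ
      rw [Finset.not_nonempty_iff_eq_empty] at hJ
      simp [hJ] at h
      linarith
    have h1 : ∑ i ∈ J, k * ∑ l, x l < ∑ i ∈ J, x i := Finset.sum_lt_sum_of_nonempty hJ hmem
    have h2 : ∑ i ∈ J, x i ≤ ∑ i, x i :=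
      Finset.sum_le_univ_sum_of_nonneg fun i => (hx i).le
    have h3 : 0 ≤ ∑ i, x i := Finset.sum_nonneg fun i _ => (hx i).le
    rw [Finset.sum_const, nsmul_eq_mul] at h1
    nlinarith
  · rw [max_eq_left h.le, measureReal_pi_expMeasure_one hms]
    set a := 1 - J.card * k with ha
    -- Subtracting `k ∑ x` on `J` sends the event to the positive orthant and multiplies the sum by
    -- `a`. Written in terms of the new sum, the inverse adds `(k / a) ∑ y` on `J`.
    have hdet : 1 + J.card * (k / a) = a⁻¹ := by
      field_simp
      rw [ha]; ring
    have himage : {x : ι → ℝ | ∀ i ∈ J, k * ∑ l, x l < x i} ∩ (Set.univ.pi fun _ => Set.Ioi 0) =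
        addSumOn J (k / a) '' Set.univ.pi fun _ => Set.Ioi 0 := by
      ext x
      constructor
      · rintro ⟨hx, hpos⟩
        have hsum : ∑ i, (x i - if i ∈ J then k * ∑ l, x l else 0) = a * ∑ l, x l := by
          simp only [Finset.sum_sub_distrib, Finset.sum_ite_mem, Finset.univ_inter,
            Finset.sum_const, nsmul_eq_mul, ha]
          ring
        refine ⟨fun i => x i - if i ∈ J then k * ∑ l, x l else 0, fun i _ => ?_, ?_⟩
        · by_cases hi : i ∈ J
          · simpa [hi] using hx i hi
          · simpa [hi] using hpos i (Set.mem_univ i)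
        · ext i
          rw [addSumOn_apply, hsum, ← mul_assoc, div_mul_cancel₀ _ h.ne']
          ring
      · rintro ⟨y, hy, rfl⟩
        have hS : 0 ≤ ∑ l, y l := Finset.sum_nonneg fun i _ => (hy i (Set.mem_univ i)).le
        refine ⟨fun i hi => ?_, fun i _ => ?_⟩
        · rw [sum_addSumOn, addSumOn_apply, if_pos hi, hdet]
          have := hy i (Set.mem_univ i)
          rw [Set.mem_Ioi] at this
          have h2 : k * (a⁻¹ * ∑ l, y l) = k / a * ∑ l, y l := by ring
          linarith
        · rw [Set.mem_Ioi, addSumOn_apply]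
          have := hy i (Set.mem_univ i)
          rw [Set.mem_Ioi] at this
          split_ifs
          · positivity
          · simpa using this
    have hinj : Function.Injective (addSumOn J (k / a)) := by
      intro y z hyz
      have hs : ∑ i, y i = ∑ i, z i := by
        have := sum_addSumOn J (k / a) y
        rw [hyz, sum_addSumOn, hdet] at this
        exact (mul_left_cancel₀ (inv_ne_zero h.ne') this).symm
      ext i
      have := congrFun hyz i
      rw [addSumOn_apply, addSumOn_apply, hs] at this
      exact add_right_cancel this
    rw [himage, integral_image_eq_integral_abs_det_fderiv_smul volume
      (MeasurableSet.univ_pi fun _ => measurableSet_Ioi)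
      (fun x _ => (addSumOn J (k / a)).hasFDerivWithinAt) hinj.injOn]
    simp_rw [sum_addSumOn, det_addSumOn, hdet, smul_eq_mul]
    -- The integral contributes `a ^ card ι` and the Jacobian `a⁻¹`, whence the exponent `card ι -
    -- 1`.
    rw [integral_const_mul, setIntegral_exp_neg_mul_sum (inv_pos.2 h), inv_inv,
      abs_of_pos (inv_pos.2 h)]
    obtain ⟨m, hm⟩ : ∃ m, Fintype.card ι = m + 1 := ⟨Fintype.card ι - 1, by omega⟩
    rw [hm, Nat.add_sub_cancel, pow_succ', ← mul_assoc, inv_mul_cancel₀ h.ne', one_mul]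

/-- **Fisher's formula**: for i.i.d. standard exponential variables, the probability that the
largest one exceeds the `k`-th part of the total sum. -/
theorem measureReal_exists_mul_sum_lt (hι : 2 ≤ Fintype.card ι) {k : ℝ} (hk : 0 ≤ k) :
    (Measure.pi (fun _ : ι => expMeasure 1)).real {x | ∃ i, k * ∑ l, x l < x i} =
      fisherTail (Fintype.card ι) k := by
  classical
  have hU : {x : ι → ℝ | ∃ i, k * ∑ l, x l < x i} =
      ⋃ i ∈ (Finset.univ : Finset ι), {x | k * ∑ l, x l < x i} := by ext; simp
  rw [hU, measureReal_biUnion_eq_sum_powerset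
    fun i _ => measurableSet_lt (by fun_prop) (by fun_prop)]
  have hterm : ∀ J : Finset ι, (⋂ i ∈ J, {x : ι → ℝ | k * ∑ l, x l < x i}) =
      {x | ∀ i ∈ J, k * ∑ l, x l < x i} := by intro J; ext; simp
  simp_rw [hterm, measureReal_forall_mul_sum_lt hι hk]
  rw [fisherTail, Finset.sum_filter]
  -- The summand depends on `J` only through its cardinality; the value `0` at `j = 0` accounts for
  -- the excluded empty set.
  have h0 := Finset.sum_powerset_apply_card (x := (Finset.univ : Finset ι))
    (fun j : ℕ => if j = 0 then (0 : ℝ) else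
    (-1) ^ (j + 1) * max (1 - j * k) 0 ^ (Fintype.card ι - 1))
  have h1 : ∀ J : Finset ι, (if J.Nonempty then (-1 : ℝ) ^ (J.card + 1) *
      max (1 - J.card * k) 0 ^ (Fintype.card ι - 1) else 0) =
      if J.card = 0 then (0 : ℝ) else
        (-1) ^ (J.card + 1) * max (1 - J.card * k) 0 ^ (Fintype.card ι - 1) := by
    intro J
    rcases J.eq_empty_or_nonempty with rfl | hJ
    · simp
    · rw [if_pos hJ, if_neg hJ.card_pos.ne']
  simp_rw [h1, h0, Finset.card_univ]
  rw [Finset.range_eq_Ico, Finset.sum_eq_sum_Ico_succ_bot (Nat.succ_pos _)]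
  simp only [if_true, smul_zero, zero_add]
  refine Finset.sum_congr (by ext; simp) fun j hj => ?_
  rw [if_neg (by simp at hj; omega), nsmul_eq_mul]
  ring

end Exponential

/-! ### Monotonicity of the tail function and uniqueness of the critical value. -/

lemma hasDerivAt_max_zero_pow (n : ℕ) (x : ℝ) :
    HasDerivAt (fun x : ℝ => (max x 0) ^ (n + 2)) ((n + 2) * (max x 0) ^ (n + 1)) x := by
  have hpow : ∀ x : ℝ, HasDerivAt (fun x : ℝ => x ^ (n + 2)) ((n + 2) * x ^ (n + 1)) x := by
    intro x
    simpa using hasDerivAt_pow (n + 2) x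
  have hl : ∀ x : ℝ, x ≤ 0 → HasDerivWithinAt (fun x : ℝ => (max x 0) ^ (n + 2))
      ((n + 2) * (max x 0) ^ (n + 1)) (Set.Iic 0) x := by
    intro x hx
    have h0 : (n + 2) * (max x 0) ^ (n + 1) = 0 := by simp [max_eq_right hx]
    rw [h0]
    refine (hasDerivWithinAt_const x _ (0 : ℝ)).congr (fun y hy => ?_) ?_
    · simp [max_eq_right (Set.mem_Iic.1 hy)]
    · simp [max_eq_right hx]
  have hr : ∀ x : ℝ, 0 ≤ x → HasDerivWithinAt (fun x : ℝ => (max x 0) ^ (n + 2))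
      ((n + 2) * (max x 0) ^ (n + 1)) (Set.Ici 0) x := by
    intro x hx
    rw [max_eq_left hx]
    refine (hpow x).hasDerivWithinAt.congr (fun y hy => ?_) ?_
    · simp [max_eq_left (Set.mem_Ici.1 hy)]
    · simp [max_eq_left hx]
  rcases lt_trichotomy x 0 with hx | rfl | hx
  · exact (hl x hx.le).hasDerivAt (Iic_mem_nhds hx)
  · have := (hl 0 le_rfl).union (hr 0 le_rfl)
    rwa [Set.Iic_union_Ici, hasDerivWithinAt_univ] at this
  · exact (hr x hx.le).hasDerivAt (Ici_mem_nhds hx)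

lemma continuous_fisherTail (q : ℕ) : Continuous (fisherTail q) := by
  unfold fisherTail
  fun_prop

lemma fisherTail_of_one_le {q : ℕ} (hq : 2 ≤ q) {k : ℝ} (hk : 1 ≤ k) : fisherTail q k = 0 := by
  refine Finset.sum_eq_zero fun j hj => ?_
  have hj1 : (1 : ℝ) ≤ j := by exact_mod_cast (Finset.mem_Icc.1 hj).1
  rw [max_eq_right (by nlinarith), zero_pow (by omega), mul_zero]

/-- The missing term `j = 0` of the alternating sum is `1`. The completed sum is the form in which
the derivative recursion appears. -/
lemma fisherTail_eq_one_sub (q : ℕ) (k : ℝ) :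
    1 - fisherTail q k = ∑ i ∈ Finset.range (q + 1),
      (-1 : ℝ) ^ i * (q.choose i : ℝ) * (max (1 - i * k) 0) ^ (q - 1) := by
  rw [Finset.range_eq_Ico, Finset.sum_eq_sum_Ico_succ_bot (Nat.succ_pos _), fisherTail,
    sub_eq_add_neg, ← Finset.sum_neg_distrib]
  congr 1
  · simp
  · refine Finset.sum_congr (by ext; simp) fun j _ => ?_
    ring

lemma fisherTail_zero {q : ℕ} (hq : 1 ≤ q) : fisherTail q 0 = 1 := by
  have h := fisherTail_eq_one_sub q 0
  have h2 := Int.alternating_sum_range_choose_of_ne (n := q) (by omega)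
  have h3 : ∑ i ∈ Finset.range (q + 1), (-1 : ℝ) ^ i * (q.choose i : ℝ) = 0 := by
    exact_mod_cast h2
  simp only [mul_zero, sub_zero, zero_le_one, max_eq_left, one_pow, mul_one] at h
  linarith

/-- Combine `(i + 1) C(m + 3, i + 1) = (m + 3) C(m + 2, i)` with `1 - (i + 1) k = (1 - k) (1 - i k /
(1 - k))`. The factor `1 - k` leaves the positive part because it is positive. -/
lemma hasDerivAt_fisherTail {m : ℕ} {k : ℝ} (hk : k < 1) :
    HasDerivAt (fisherTail (m + 3))
      (-((m + 3) * (m + 2) * (1 - k) ^ (m + 1) * (1 - fisherTail (m + 2) (k / (1 - k))))) k := by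
  have h1 : HasDerivAt (fisherTail (m + 3)) (∑ j ∈ Finset.Icc 1 (m + 3),
      (-1 : ℝ) ^ (j + 1) * ((m + 3).choose j : ℝ) *
        (((m + 2) * (max (1 - j * k) 0) ^ (m + 1)) * (-(j * 1)))) k := by
    refine HasDerivAt.fun_sum fun j _ => HasDerivAt.const_mul _ ?_
    have hinner : HasDerivAt (fun x : ℝ => 1 - j * x) (-((j : ℝ) * 1)) k :=
      ((hasDerivAt_id k).const_mul (j : ℝ)).const_sub 1
    exact HasDerivAt.comp k (hasDerivAt_max_zero_pow m (1 - j * k)) hinner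
  convert h1 using 1
  have hpos : 0 < 1 - k := by linarith
  rw [fisherTail_eq_one_sub, Finset.mul_sum, ← Finset.sum_neg_distrib]
  have hIcc : Finset.Icc 1 (m + 3) = Finset.Ico (0 + 1) (m + 2 + 1 + 1) := by ext; simp
  rw [hIcc, ← Finset.sum_Ico_add', ← Finset.range_eq_Ico]
  refine Finset.sum_congr rfl fun i _ => ?_
  have hmax : max (1 - ((i + 1 : ℕ) : ℝ) * k) 0 = (1 - k) * max (1 - i * (k / (1 - k))) 0 := by
    rw [mul_max_of_nonneg _ _ hpos.le, mul_zero]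
    congr 1
    push_cast
    field_simp
    ring
  have hchoose : ((m + 3).choose (i + 1) : ℝ) * ((i + 1 : ℕ) : ℝ) =
      (m + 3) * ((m + 2).choose i : ℝ) := by
    have := Nat.add_one_mul_choose_eq (m + 2) i
    have h : (((m + 2 + 1) * (m + 2).choose i : ℕ) : ℝ) =
        (((m + 2 + 1).choose (i + 1) * (i + 1) : ℕ) : ℝ) := by
      rw [this]
    push_cast at h ⊢
    linarith
  rw [hmax, mul_pow]
  have e : (-1 : ℝ) ^ (i + 1 + 1) = (-1) ^ i := by rw [pow_add, pow_add]; norm_num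
  rw [e, show m + 2 - 1 = m + 1 by omega]
  linear_combination (-(m + 2 : ℝ) * (1 - k) ^ (m + 1) * (-1) ^ i *
    max (1 - i * (k / (1 - k))) 0 ^ (m + 1)) * (-hchoose)

lemma fisherTail_two (k : ℝ) : fisherTail 2 k = 2 * max (1 - k) 0 - max (1 - 2 * k) 0 := by
  have : Finset.Icc 1 2 = {1, 2} := rfl
  simp [fisherTail, this]
  ring

/-- The tail function is constantly `1` on `(-∞, 1/q]` and strictly decreasing on `[1/q, 1]`. -/
lemma fisherTail_eq_one_and_strictAntiOn (m : ℕ) :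
    (∀ k : ℝ, k ≤ 1 / (m + 2 : ℕ) → fisherTail (m + 2) k = 1) ∧
      StrictAntiOn (fisherTail (m + 2)) (Set.Icc (1 / (m + 2 : ℕ)) 1) := by
  induction m with
  | zero =>
    refine ⟨fun k hk => ?_, fun x hx y hy hxy => ?_⟩
    · norm_num at hk
      rw [fisherTail_two, max_eq_left (by linarith), max_eq_left (by linarith)]
      ring
    · obtain ⟨hx1, hx2⟩ := hx
      obtain ⟨hy1, hy2⟩ := hy
      norm_num at hx1 hy1
      rw [fisherTail_two, fisherTail_two, max_eq_left (by linarith), max_eq_right (by linarith),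
        max_eq_left (by linarith), max_eq_right (by linarith)]
      linarith
  | succ m ih =>
    obtain ⟨ih1, ih2⟩ := ih
    have hq : (0 : ℝ) < m + 3 := by positivity
    have hq2 : (0 : ℝ) < m + 2 := by positivity
    have hcast : (((m + 1 + 2 : ℕ)) : ℝ) = m + 3 := by push_cast; ring
    have hlt1 : (1 : ℝ) / (m + 3) < 1 := by rw [div_lt_one hq]; linarith
    rw [hcast]
    -- The map `k ↦ k / (1 - k)` carries `1 / (m + 3)` to `1 / (m + 2)`, so the two thresholds match
    -- in the induction.
    have hderiv : ∀ k : ℝ, k < 1 / (m + 3) → deriv (fisherTail (m + 3)) k = 0 := by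
      intro k hk
      have hk1 : k < 1 := hk.trans hlt1
      rw [(hasDerivAt_fisherTail hk1).deriv, ih1]
      · ring
      · push_cast
        rw [lt_div_iff₀ hq] at hk
        rw [div_le_div_iff₀ (by linarith) hq2]
        linarith
    refine ⟨fun k hk => ?_, ?_⟩
    -- Constancy is obtained as monotone and antitone at once, compared with the value `1` at `0`.
    · have hanti : AntitoneOn (fisherTail (m + 3)) (Set.Iic (1 / (m + 3 : ℝ))) := by
        refine antitoneOn_of_deriv_nonpos (convex_Iic _) (continuous_fisherTail _).continuousOn
          (fun x hx => ?_) (fun x hx => ?_) <;> rw [interior_Iic] at hx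
        · exact (hasDerivAt_fisherTail ((Set.mem_Iio.1 hx).trans
            hlt1)).differentiableAt.differentiableWithinAt
        · exact (hderiv x hx).le
      have hmono : MonotoneOn (fisherTail (m + 3)) (Set.Iic (1 / (m + 3 : ℝ))) := by
        refine monotoneOn_of_deriv_nonneg (convex_Iic _) (continuous_fisherTail _).continuousOn
          (fun x hx => ?_) (fun x hx => ?_) <;> rw [interior_Iic] at hx
        · exact (hasDerivAt_fisherTail ((Set.mem_Iio.1 hx).trans
            hlt1)).differentiableAt.differentiableWithinAt
        · exact (hderiv x hx).ge
      have h0 : (0 : ℝ) ∈ Set.Iic (1 / (m + 3 : ℝ)) := by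
        rw [Set.mem_Iic]; positivity
      change fisherTail (m + 3) k = 1
      rw [← fisherTail_zero (q := m + 3) (by omega)]
      rcases le_total k 0 with h | h
      · exact le_antisymm (hmono hk h0 h) (hanti hk h0 h)
      · exact le_antisymm (hanti h0 hk h) (hmono h0 hk h)
    · refine strictAntiOn_of_deriv_neg (convex_Icc _ _) (continuous_fisherTail _).continuousOn
        fun k hk => ?_
      rw [interior_Icc] at hk
      obtain ⟨hk1, hk2⟩ := hk
      change deriv (fisherTail (m + 3)) k < 0
      rw [(hasDerivAt_fisherTail hk2).deriv]
      have hpos : 0 < 1 - k := by linarith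
      -- Past its threshold the smaller tail is below `1`: by strict decrease up to `1`, and because
      -- it vanishes beyond.
      have hlt : fisherTail (m + 2) (k / (1 - k)) < 1 := by
        have hy : 1 / (m + 2 : ℕ) < k / (1 - k) := by
          push_cast
          rw [div_lt_iff₀ hq] at hk1
          rw [div_lt_div_iff₀ hq2 hpos]
          linarith
        have hle1 : (1 : ℝ) / (m + 2 : ℕ) ≤ 1 := by
          push_cast
          rw [div_le_one hq2]; linarith
        rcases le_total (k / (1 - k)) 1 with h | h
        · exact (ih2 ⟨le_rfl, hle1⟩ ⟨hy.le, h⟩ hy).trans_eq (ih1 _ le_rfl)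
        · rw [fisherTail_of_one_le (by omega) h]
          exact one_pos
      have : 0 < 1 - fisherTail (m + 2) (k / (1 - k)) := by linarith
      have := mul_pos (show (0 : ℝ) < (m + 3) * (m + 2) * (1 - k) ^ (m + 1) by positivity) this
      linarith

lemma fisherTail_eq_one {q : ℕ} (hq : 2 ≤ q) {k : ℝ} (hk : k ≤ 1 / q) : fisherTail q k = 1 := by
  obtain ⟨m, rfl⟩ := Nat.exists_eq_add_of_le' hq
  exact (fisherTail_eq_one_and_strictAntiOn m).1 k hk

lemma strictAntiOn_fisherTail {q : ℕ} (hq : 2 ≤ q) :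
    StrictAntiOn (fisherTail q) (Set.Icc (1 / q) 1) := by
  obtain ⟨m, rfl⟩ := Nat.exists_eq_add_of_le' hq
  exact (fisherTail_eq_one_and_strictAntiOn m).2

lemma mem_Ioo_of_fisherTail_eq {q : ℕ} (hq : 2 ≤ q) {α k : ℝ} (h0 : 0 < α) (h1 : α < 1)
    (hk : fisherTail q k = α) : k ∈ Set.Ioo (1 / q : ℝ) 1 := by
  constructor
  · by_contra! h
    rw [fisherTail_eq_one hq h] at hk
    linarith
  · by_contra! h
    rw [fisherTail_of_one_le hq h] at hk
    linarith

theorem existsUnique_fisherTail_eq {q : ℕ} (hq : 2 ≤ q) {α : ℝ} (h0 : 0 < α) (h1 : α < 1) :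
    ∃! k : ℝ, fisherTail q k = α := by
  have hle : (1 : ℝ) / q ≤ 1 := by
    have : (2 : ℝ) ≤ q := by exact_mod_cast hq
    rw [div_le_one (by linarith)]; linarith
  have hivt := intermediate_value_Icc' hle (continuous_fisherTail q).continuousOn
  rw [fisherTail_eq_one hq le_rfl, fisherTail_of_one_le hq le_rfl] at hivt
  obtain ⟨k, hk, hkα⟩ := hivt ⟨h0.le, h1.le⟩
  refine ⟨k, hkα, fun y hy => ?_⟩
  exact (strictAntiOn_fisherTail hq).injOn
    (Set.Ioo_subset_Icc_self (mem_Ioo_of_fisherTail_eq hq h0 h1 hy)) hk (hy.trans hkα.symm)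

/-- With a single frequency the tail is constant. -/
lemma fisherTail_one (k : ℝ) : fisherTail 1 k = 1 := by
  simp [fisherTail]

/-- The standard normal distribution on `Fin d → ℝ`. -/
noncomputable abbrev stdNormal (d : ℕ) : Measure (Fin d → ℝ) :=
  Measure.pi fun _ => gaussianReal 0 1

/-! ### Periodograms and Fisher's statistic of a standard normal vector. -/

section Normal

variable {d : ℕ}

lemma hasLaw_eval_stdNormal (l : Fin d) :
    HasLaw (fun x : Fin d → ℝ => x l) (gaussianReal 0 1) (stdNormal d) :=
  ⟨(measurable_pi_apply l).aemeasurable,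
    (measurePreserving_eval (fun _ : Fin d => gaussianReal 0 1) l).map_eq⟩

lemma iIndepFun_eval_stdNormal :
    iIndepFun (fun (l : Fin d) (x : Fin d → ℝ) => x l) (stdNormal d) :=
  iIndepFun_pi (X := fun _ x => x) fun _ => aemeasurable_id

lemma hasGaussianLaw_id_stdNormal : HasGaussianLaw (fun x : Fin d → ℝ => x) (stdNormal d) :=
  iIndepFun_eval_stdNormal.hasGaussianLaw fun l => (hasLaw_eval_stdNormal l).hasGaussianLaw

lemma covariance_eval_stdNormal (l m : Fin d) :
    cov[fun x : Fin d → ℝ => x l, fun x => x m; stdNormal d] = if l = m then 1 else 0 := by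
  split_ifs with h
  · subst h
    rw [covariance_self (measurable_pi_apply l).aemeasurable, (hasLaw_eval_stdNormal l).variance_eq]
    simp
  · exact (iIndepFun_eval_stdNormal.indepFun h).covariance_eq_zero
      (hasLaw_eval_stdNormal l).hasGaussianLaw.memLp_two
      (hasLaw_eval_stdNormal m).hasGaussianLaw.memLp_two

lemma covariance_linear_stdNormal (v w : Fin d → ℝ) :
    cov[fun x => ∑ l, v l * x l, fun x => ∑ l, w l * x l; stdNormal d] = ∑ l, v l * w l := by
  have hL : ∀ (c : ℝ) (l : Fin d), MemLp (fun x : Fin d → ℝ => c * x l) 2 (stdNormal d) :=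
    fun c l => (hasLaw_eval_stdNormal l).hasGaussianLaw.memLp_two.const_mul c
  rw [covariance_fun_sum_fun_sum (fun l => hL _ l) (fun l => hL _ l)]
  simp_rw [covariance_const_mul_left, covariance_const_mul_right, covariance_eval_stdNormal]
  simp

lemma integral_linear_stdNormal (v : Fin d → ℝ) :
    ∫ x, ∑ l, v l * x l ∂stdNormal d = 0 := by
  rw [integral_finsetSum _ fun l _ =>
    (hasLaw_eval_stdNormal l).hasGaussianLaw.integrable.const_mul _]
  refine Finset.sum_eq_zero fun l _ => ?_
  rw [integral_const_mul, (hasLaw_eval_stdNormal l).integral_eq]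
  simp

/-- Half the squared lengths of the projections of a standard normal vector to mutually
orthogonal planes are i.i.d. standard exponential. -/
lemma map_half_sq_add_sq_stdNormal {κ : Type*} [Fintype κ] [DecidableEq κ]
    (v : κ → Fin 2 → Fin d → ℝ)
    (hv : ∀ i a j b, ∑ l, v i a l * v j b l = if i = j ∧ a = b then 1 else 0) :
    (stdNormal d).map (fun x i => ((∑ l, v i 0 l * x l) ^ 2 + (∑ l, v i 1 l * x l) ^ 2) / 2) =
      Measure.pi fun _ : κ => expMeasure 1 := by
  let X : κ → Fin 2 → (Fin d → ℝ) → ℝ := fun i a x => ∑ l, v i a l * x l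
  have hXm : ∀ i a, Measurable (X i a) := fun i a => by fun_prop
  have hcov : ∀ i a j b, cov[X i a, X j b; stdNormal d] = if i = j ∧ a = b then 1 else 0 :=
    fun i a j b => (covariance_linear_stdNormal _ _).trans (hv i a j b)
  -- Joint normality turns orthogonality into independence, both between the planes and between the
  -- two coordinates of one plane.
  have hgauss : HasGaussianLaw (fun x i a => X i a x) (stdNormal d) := by
    let T : (Fin d → ℝ) →ₗ[ℝ] (κ → Fin 2 → ℝ) :=
      { toFun := fun x i a => X i a x
        map_add' := fun x y => by
          ext i a; simp [X, mul_add, Finset.sum_add_distrib]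
        map_smul' := fun c x => by
          ext i a; simp [X, Finset.mul_sum, mul_left_comm] }
    exact hasGaussianLaw_id_stdNormal.map_fun T.toContinuousLinearMap
  have hlaw : ∀ i a, (stdNormal d).map (X i a) = gaussianReal 0 1 := by
    intro i a
    have h1 : HasGaussianLaw (X i a) (stdNormal d) :=
      hgauss.map_fun ((ContinuousLinearMap.proj (R := ℝ) (φ := fun _ : Fin 2 => ℝ) a).comp
        (ContinuousLinearMap.proj (φ := fun _ : κ => Fin 2 → ℝ) i))
    rw [h1.map_eq_gaussianReal, integral_linear_stdNormal, ← covariance_self (hXm i a).aemeasurable,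
      hcov]
    simp
  have hind : iIndepFun (fun i x a => X i a x) (stdNormal d) :=
    hgauss.iIndepFun_of_covariance_eval fun i j hij a b => by rw [hcov]; simp [hij]
  have hind2 := hind.comp (fun _ (u : Fin 2 → ℝ) => (u 0 ^ 2 + u 1 ^ 2) / 2)
    (fun _ => by fun_prop)
  have hpair : ∀ i, (stdNormal d).map
      ((fun (u : Fin 2 → ℝ) => (u 0 ^ 2 + u 1 ^ 2) / 2) ∘ fun x a => X i a x) = expMeasure 1 := by
    intro i
    have hg2 : HasGaussianLaw (fun x => (X i 0 x, X i 1 x)) (stdNormal d) :=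
      hgauss.map_fun
        (((ContinuousLinearMap.proj (R := ℝ) (φ := fun _ : Fin 2 => ℝ) 0).prod
          (ContinuousLinearMap.proj 1)).comp
            (ContinuousLinearMap.proj (φ := fun _ : κ => Fin 2 → ℝ) i))
    have hI : IndepFun (X i 0) (X i 1) (stdNormal d) :=
      hg2.indepFun_of_covariance_eq_zero (by rw [hcov]; simp)
    rw [indepFun_iff_map_prod_eq_prod_map_map (hXm i 0).aemeasurable (hXm i 1).aemeasurable,
      hlaw, hlaw] at hI
    rw [← map_half_sq_add_sq_gaussian, ← hI, Measure.map_map (by fun_prop) (by fun_prop)]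
    rfl
  have := (iIndepFun_iff_map_fun_eq_pi_map (fun i => by fun_prop)).1 hind2
  simp_rw [hpair] at this
  exact this

/-- A geometric sum over the powers of a `d`-th root of unity other than `1`. -/
lemma sum_exp_int_mul {a : ℤ} (hd : d ≠ 0) (ha : ¬ (d : ℤ) ∣ a) :
    ∑ l : Fin d, Complex.exp (((((l : ℕ) + 1 : ℕ) * (2 * Real.pi * a / d) : ℝ) : ℂ) *
      Complex.I) = 0 := by
  have hd' : (d : ℂ) ≠ 0 := by exact_mod_cast hd
  set z : ℂ := Complex.exp (2 * Real.pi * Complex.I * (a / d)) with hz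
  have hterm : ∀ l : Fin d,
      Complex.exp (((((l : ℕ) + 1 : ℕ) * (2 * Real.pi * a / d) : ℝ) : ℂ) * Complex.I) =
        z * z ^ (l : ℕ) := by
    intro l
    rw [hz, ← pow_succ', ← Complex.exp_nat_mul]
    congr 1
    push_cast
    ring
  simp_rw [hterm, ← Finset.mul_sum]
  have hzd : z ^ d = 1 := by
    rw [hz, ← Complex.exp_nat_mul, Complex.exp_eq_one_iff]
    exact ⟨a, by field_simp⟩
  have hz1 : z ≠ 1 := by
    rw [hz, Ne, Complex.exp_eq_one_iff]
    rintro ⟨n, hn⟩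
    apply ha
    refine ⟨n, ?_⟩
    have h2 : (2 * Real.pi * Complex.I : ℂ) ≠ 0 := Complex.two_pi_I_ne_zero
    have h3 : (a / d : ℂ) = n := by
      apply mul_left_cancel₀ h2
      rw [hn]; ring
    rw [div_eq_iff hd'] at h3
    have h4 : (a : ℂ) = ((d * n : ℤ) : ℂ) := by push_cast; rw [h3]; ring
    exact_mod_cast h4
  have hgeom : ∑ l : Fin d, z ^ (l : ℕ) = 0 := by
    rw [Fin.sum_univ_eq_sum_range (fun l => z ^ l), geom_sum_eq hz1, hzd, sub_self, zero_div]
  rw [hgeom, mul_zero]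

lemma sum_cos_int_mul {a : ℤ} (hd : d ≠ 0) (ha : ¬ (d : ℤ) ∣ a) :
    ∑ l : Fin d, Real.cos (((l : ℕ) + 1 : ℕ) * (2 * Real.pi * a / d)) = 0 := by
  have := congrArg Complex.re (sum_exp_int_mul hd ha)
  simpa only [Complex.re_sum, Complex.exp_ofReal_mul_I_re, Complex.zero_re] using this

lemma sum_sin_int_mul (a : ℤ) (hd : d ≠ 0) :
    ∑ l : Fin d, Real.sin (((l : ℕ) + 1 : ℕ) * (2 * Real.pi * a / d)) = 0 := by
  by_cases ha : (d : ℤ) ∣ a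
  · obtain ⟨b, rfl⟩ := ha
    refine Finset.sum_eq_zero fun l _ => ?_
    have hd' : (d : ℝ) ≠ 0 := by exact_mod_cast hd
    rw [Real.sin_eq_zero_iff]
    refine ⟨((l : ℕ) + 1 : ℕ) * (2 * b), ?_⟩
    push_cast
    field_simp
  · have := congrArg Complex.im (sum_exp_int_mul hd ha)
    simpa only [Complex.im_sum, Complex.exp_ofReal_mul_I_im, Complex.zero_im] using this

/-- The normalized trigonometric vectors: cosines for `a = 0`, sines for `a = 1`. -/
noncomputable def trigVec (d j : ℕ) (a : Fin 2) (l : Fin d) : ℝ :=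
  √(2 / d) * ![Real.cos (((l : ℕ) + 1 : ℕ) * fourierFreq d j),
    Real.sin (((l : ℕ) + 1 : ℕ) * fourierFreq d j)] a

lemma sum_trigVec_mul_trigVec {j k : ℕ} (hj : j ∈ Finset.Icc 1 (numFreq d))
    (hk : k ∈ Finset.Icc 1 (numFreq d)) (a b : Fin 2) :
    ∑ l, trigVec d j a l * trigVec d k b l = if j = k ∧ a = b then 1 else 0 := by
  rw [Finset.mem_Icc, numFreq] at hj hk
  have hd : d ≠ 0 := by omega
  have hd' : (d : ℝ) ≠ 0 := by exact_mod_cast hd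
  -- Here `q = ⌊(d - 1) / 2⌋` matters: it forces `0 < j + k < d`, which rules out the frequencies
  -- `0` and `π`.
  have hplus : ¬ (d : ℤ) ∣ (j + k : ℤ) := by
    intro h
    have := Int.le_of_dvd (by omega) h
    omega
  have hminus : (d : ℤ) ∣ (j - k : ℤ) → j = k := by
    intro h
    have := Int.eq_zero_of_abs_lt_dvd h (by rw [abs_lt]; constructor <;> omega)
    omega
  have hcp := sum_cos_int_mul hd hplus
  have hsp := sum_sin_int_mul (d := d) (j + k) hd
  have hsm := sum_sin_int_mul (d := d) (j - k) hd
  have hcm : ∑ l : Fin d, Real.cos (((l : ℕ) + 1 : ℕ) * (2 * Real.pi * (j - k : ℤ) / d)) =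
      if j = k then (d : ℝ) else 0 := by
    split_ifs with h
    · subst h; simp
    · exact sum_cos_int_mul hd fun h' => h (hminus h')
  have hsq : √(2 / d) * √(2 / d) = (2 / d : ℝ) := Real.mul_self_sqrt (by positivity)
  have eplus : ∀ l : Fin d, (((l : ℕ) + 1 : ℕ) : ℝ) * (2 * Real.pi * (j + k : ℤ) / d) =
      ((l : ℕ) + 1 : ℕ) * fourierFreq d j + ((l : ℕ) + 1 : ℕ) * fourierFreq d k := by
    intro l; simp only [fourierFreq]; push_cast; ring
  have eminus : ∀ l : Fin d, (((l : ℕ) + 1 : ℕ) : ℝ) * (2 * Real.pi * (j - k : ℤ) / d) =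
      ((l : ℕ) + 1 : ℕ) * fourierFreq d j - ((l : ℕ) + 1 : ℕ) * fourierFreq d k := by
    intro l; simp only [fourierFreq]; push_cast; ring
  -- After the addition formulas, the four inner products are half sums or half differences of these
  -- identities.
  simp_rw [eplus, Real.cos_add, Finset.sum_sub_distrib] at hcp
  simp_rw [eplus, Real.sin_add, Finset.sum_add_distrib] at hsp
  simp_rw [eminus, Real.cos_sub, Finset.sum_add_distrib] at hcm
  simp_rw [eminus, Real.sin_sub, Finset.sum_sub_distrib] at hsm
  have hpull : ∀ u w : Fin d → ℝ, ∑ l, √(2 / d) * u l * (√(2 / d) * w l) =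
      2 / d * ∑ l, u l * w l := by
    intro u w
    rw [Finset.mul_sum]
    refine Finset.sum_congr rfl fun l _ => ?_
    rw [mul_mul_mul_comm, hsq]
  have hval : (2 / d : ℝ) * ((if j = k then (d : ℝ) else 0) / 2) = if j = k then 1 else 0 := by
    split_ifs
    · field_simp
    · simp
  unfold trigVec
  rw [hpull]
  fin_cases a <;> fin_cases b <;> dsimp only [Fin.zero_eta, Fin.mk_one, Fin.isValue,
    Matrix.cons_val_zero, Matrix.cons_val_one, Matrix.cons_val_fin_one]
  · rw [show ∑ l : Fin d, _ = (if j = k then (d : ℝ) else 0) / 2 by linarith, hval]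
    simp
  · rw [show ∑ l : Fin d, _ = (0 : ℝ) by linarith]
    simp
  · rw [show ∑ l : Fin d, _ = (0 : ℝ) by linarith]
    simp
  · rw [show ∑ l : Fin d, _ = (if j = k then (d : ℝ) else 0) / 2 by linarith, hval]
    simp

/-- Since `1 / d = (2 / d) / 2`, normalizing the trigonometric vectors leaves the factor `1 / 2`
that matches the standard exponential law. -/
lemma periodogram_eq_trigVec (x : Fin d → ℝ) (j : ℕ) :
    periodogram x j =
      ((∑ l, trigVec d j 0 l * x l) ^ 2 + (∑ l, trigVec d j 1 l * x l) ^ 2) / 2 := by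
  have hterm : ∀ l : Fin d, (x l : ℂ) *
      Complex.exp (-Complex.I * (((l : ℕ) + 1 : ℕ) : ℂ) * (fourierFreq d j : ℂ)) =
      x l * Complex.exp (((-(((l : ℕ) + 1 : ℕ) * fourierFreq d j) : ℝ) : ℂ) * Complex.I) := by
    intro l
    congr 2
    push_cast
    ring
  have hsq : √(2 / d) ^ 2 = (2 / d : ℝ) := Real.sq_sqrt (by positivity)
  have hpull : ∀ u : Fin d → ℝ, (∑ l, √(2 / d) * u l * x l) ^ 2 =
      2 / d * (∑ l, x l * u l) ^ 2 := by
    intro u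
    have h : ∑ l, √(2 / d) * u l * x l = √(2 / d) * ∑ l, x l * u l := by
      rw [Finset.mul_sum]
      exact Finset.sum_congr rfl fun l _ => by ring
    rw [h, mul_pow, hsq]
  rw [periodogram, Finset.sum_congr rfl fun l _ => hterm l]
  unfold trigVec
  rw [hpull, hpull, Complex.sq_norm, Complex.normSq_apply, Complex.re_sum, Complex.im_sum]
  simp only [Complex.re_ofReal_mul, Complex.im_ofReal_mul, Complex.exp_ofReal_mul_I_re,
    Complex.exp_ofReal_mul_I_im, Real.cos_neg, Real.sin_neg, mul_neg, Finset.sum_neg_distrib,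
    Matrix.cons_val_zero, Matrix.cons_val_one, Matrix.cons_val_fin_one]
  ring

lemma map_periodogram_stdNormal :
    (stdNormal d).map (fun x (j : Finset.Icc 1 (numFreq d)) => periodogram x j) =
      Measure.pi fun _ => expMeasure 1 := by
  have h : (fun (x : Fin d → ℝ) (j : Finset.Icc 1 (numFreq d)) => periodogram x j) =
      fun x (j : Finset.Icc 1 (numFreq d)) =>
        ((∑ l, trigVec d j 0 l * x l) ^ 2 + (∑ l, trigVec d j 1 l * x l) ^ 2) / 2 := by
    ext x j
    exact periodogram_eq_trigVec x j
  rw [h]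
  refine map_half_sq_add_sq_stdNormal (fun (j : Finset.Icc 1 (numFreq d)) => trigVec d j)
    fun i a j b => ?_
  rw [sum_trigVec_mul_trigVec i.2 j.2]
  exact if_congr (by rw [Subtype.ext_iff]) rfl rfl

lemma periodogram_nonneg (x : Fin d → ℝ) (j : ℕ) : 0 ≤ periodogram x j := by
  unfold periodogram; positivity

lemma continuous_periodogram (j : ℕ) : Continuous fun x : Fin d → ℝ => periodogram x j := by
  unfold periodogram; fun_prop

lemma isClosed_degenerateSet (d : ℕ) : IsClosed (degenerateSet d) := by
  have : degenerateSet d = ⋂ j ∈ Finset.Icc 1 (numFreq d), {x | periodogram x j = 0} := by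
    ext; simp [degenerateSet]
  rw [this]
  exact isClosed_biInter fun j _ => isClosed_eq (continuous_periodogram j) continuous_const

lemma nonempty_frequencies (hd : 3 ≤ d) : Nonempty (Finset.Icc 1 (numFreq d)) :=
  ⟨⟨1, by rw [Finset.mem_Icc, numFreq]; omega⟩⟩

lemma sum_periodogram_pos {x : Fin d → ℝ} (hx : x ∉ degenerateSet d) :
    0 < ∑ m ∈ Finset.Icc 1 (numFreq d), periodogram x m := by
  simp only [degenerateSet, Set.mem_ofPred_eq, not_forall] at hx
  obtain ⟨j, hj, hne⟩ := hx
  exact Finset.sum_pos' (fun i _ => periodogram_nonneg x i)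
    ⟨j, hj, lt_of_le_of_ne (periodogram_nonneg x j) (Ne.symm hne)⟩

lemma continuous_iSup_periodogram (hd : 3 ≤ d) :
    Continuous fun x : Fin d → ℝ => ⨆ j : Finset.Icc 1 (numFreq d), periodogram x j := by
  have := nonempty_frequencies hd
  simp_rw [← Finset.sup'_univ_eq_ciSup]
  exact Continuous.finset_sup'_apply _ fun j _ => continuous_periodogram j

lemma continuous_sum_periodogram :
    Continuous fun x : Fin d → ℝ => ∑ m ∈ Finset.Icc 1 (numFreq d), periodogram x m :=
  continuous_finsetSum _ fun j _ => continuous_periodogram j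

lemma continuousOn_fisherG (hd : 3 ≤ d) :
    ContinuousOn (fisherG (d := d)) (degenerateSet d)ᶜ :=
  (continuous_iSup_periodogram hd).continuousOn.div continuous_sum_periodogram.continuousOn
    fun _ hx => (sum_periodogram_pos hx).ne'

lemma measurable_fisherG (hd : 3 ≤ d) : Measurable (fisherG (d := d)) :=
  (continuous_iSup_periodogram hd).measurable.div continuous_sum_periodogram.measurable

lemma measurable_fisherF (hd : 3 ≤ d) : Measurable (fisherF (d := d)) :=
  (measurable_fisherG hd).indicator (isClosed_degenerateSet d).measurableSet.compl

lemma fisherF_of_notMem {x : Fin d → ℝ} (hx : x ∉ degenerateSet d) : fisherF x = fisherG x :=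
  Set.indicator_of_mem (s := (degenerateSet d)ᶜ) hx _

lemma continuousOn_fisherF (hd : 3 ≤ d) :
    ContinuousOn (fisherF (d := d)) (degenerateSet d)ᶜ :=
  (continuousOn_fisherG hd).congr fun _ hx => fisherF_of_notMem hx

lemma lt_fisherG_iff (hd : 3 ≤ d) {x : Fin d → ℝ} (hx : x ∉ degenerateSet d) (k : ℝ) :
    k < fisherG x ↔ ∃ j : Finset.Icc 1 (numFreq d),
      k * ∑ m : Finset.Icc 1 (numFreq d), periodogram x m < periodogram x j := by
  have := nonempty_frequencies hd
  rw [fisherG, lt_div_iff₀ (sum_periodogram_pos hx), lt_ciSup_iff (Set.finite_range _).bddAbove,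
    Finset.sum_coe_sort (Finset.Icc 1 (numFreq d)) (fun m => periodogram x m)]

/-- Affine changes of a time series multiply its periodograms by a constant. -/
lemma periodogram_affine (c b : ℝ) (x : Fin d → ℝ) {j : ℕ} (hj : j ∈ Finset.Icc 1 (numFreq d)) :
    periodogram (fun i => c * x i + b) j = c ^ 2 * periodogram x j := by
  rw [Finset.mem_Icc, numFreq] at hj
  have hd : d ≠ 0 := by omega
  have hdvd : ¬ (d : ℤ) ∣ (j : ℤ) := by
    intro h
    have := Int.le_of_dvd (by omega) h
    omega
  have hc := sum_cos_int_mul hd hdvd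
  have hs := sum_sin_int_mul (d := d) (j : ℤ) hd
  have hsum : ∀ a, ∑ l, trigVec d j a l = 0 := by
    intro a
    unfold trigVec
    rw [← Finset.mul_sum]
    fin_cases a
    · simpa [fourierFreq] using Or.inr hc
    · simpa [fourierFreq] using Or.inr hs
  have haff : ∀ a, ∑ l, trigVec d j a l * (c * x l + b) = c * ∑ l, trigVec d j a l * x l := by
    intro a
    have : ∀ l, trigVec d j a l * (c * x l + b) =
        c * (trigVec d j a l * x l) + trigVec d j a l * b := fun l => by ring
    simp_rw [this, Finset.sum_add_distrib, ← Finset.mul_sum, ← Finset.sum_mul, hsum, zero_mul,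
      add_zero]
  rw [periodogram_eq_trigVec, periodogram_eq_trigVec, haff, haff]
  ring

/-- Numerator and denominator gain the same factor `c ^ 2`, and the degenerate set is invariant. -/
lemma fisherF_affine {c : ℝ} (hc : c ≠ 0) (b : ℝ) (x : Fin d → ℝ) :
    fisherF (fun i => c * x i + b) = fisherF x := by
  have hmem : (fun i => c * x i + b) ∈ degenerateSet d ↔ x ∈ degenerateSet d := by
    refine forall₂_congr fun j hj => ?_
    rw [periodogram_affine c b x hj, mul_eq_zero, or_iff_right (pow_ne_zero 2 hc)]
  by_cases hx : x ∈ degenerateSet d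
  · rw [fisherF, fisherF, Set.indicator_of_notMem (Set.notMem_compl_iff.2 (hmem.2 hx)),
      Set.indicator_of_notMem (Set.notMem_compl_iff.2 hx)]
  · rw [fisherF_of_notMem hx, fisherF_of_notMem (mt hmem.1 hx), fisherG, fisherG,
      Finset.sum_congr rfl fun j hj => periodogram_affine c b x hj, ← Finset.mul_sum,
      iSup_congr fun j : Finset.Icc 1 (numFreq d) => periodogram_affine c b x j.2,
      ← Real.mul_iSup_of_nonneg (sq_nonneg c), mul_div_mul_left _ _ (pow_ne_zero 2 hc)]

lemma measurable_periodograms :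
    Measurable fun (x : Fin d → ℝ) (j : Finset.Icc 1 (numFreq d)) => periodogram x j :=
  measurable_pi_lambda _ fun j => (continuous_periodogram j).measurable

lemma ae_notMem_degenerateSet (hd : 3 ≤ d) : ∀ᵐ x ∂stdNormal d, x ∉ degenerateSet d := by
  have h := ae_pos_pi_expMeasure_one (ι := Finset.Icc 1 (numFreq d))
  rw [← map_periodogram_stdNormal] at h
  filter_upwards [ae_of_ae_map measurable_periodograms.aemeasurable h] with x hx hmem
  obtain ⟨j⟩ := nonempty_frequencies hd
  exact (hx j).ne' (hmem j j.2)

/-- The distribution of Fisher's statistic of a standard normal vector. -/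
theorem measureReal_lt_fisherG (hd : 5 ≤ d) {k : ℝ} (hk : 0 ≤ k) :
    (stdNormal d).real {x | k < fisherG x} = fisherTail (numFreq d) k := by
  have hcard : Fintype.card (Finset.Icc 1 (numFreq d)) = numFreq d := by simp
  have hq : 2 ≤ numFreq d := by rw [numFreq]; omega
  have h := measureReal_exists_mul_sum_lt (ι := Finset.Icc 1 (numFreq d)) (by rwa [hcard]) hk
  rw [hcard, ← map_periodogram_stdNormal, map_measureReal_apply measurable_periodograms] at h
  · rw [← h]
    refine measureReal_congr ?_
    filter_upwards [ae_notMem_degenerateSet (d := d) (by omega)] with x hx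
    exact propext (lt_fisherG_iff (by omega) hx k)
  · have : {x : Finset.Icc 1 (numFreq d) → ℝ | ∃ i, k * ∑ l, x l < x i} =
        ⋃ i, {x | k * ∑ l, x l < x i} := by ext; simp
    rw [this]
    exact MeasurableSet.iUnion fun i => measurableSet_lt (by fun_prop) (by fun_prop)

/-- The mass at `k` is at most the drop of the continuous tail between `t` and `k` for any `0 < t <
k`; positivity of `k` leaves room for such `t`, where the tail formula applies. -/
lemma stdNormal_fisherG_eq (hd : 5 ≤ d) {k : ℝ} (hk : 0 < k) :
    stdNormal d {x | fisherG x = k} = 0 := by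
  have hm : ∀ t : ℝ, MeasurableSet {x : Fin d → ℝ | t < fisherG x} := fun t =>
    measurableSet_lt measurable_const (measurable_fisherG (by omega))
  have hle : ∀ t ∈ Set.Ioo 0 k, (stdNormal d).real {x | fisherG x = k} ≤
      fisherTail (numFreq d) t - fisherTail (numFreq d) k := by
    intro t ht
    rw [← measureReal_lt_fisherG hd ht.1.le, ← measureReal_lt_fisherG hd hk.le,
      ← measureReal_sdiff (μ := stdNormal d) (s₁ := {x | t < fisherG x}) (s₂ := {x | k < fisherG x})
        (fun x (hx : k < fisherG x) => ht.2.trans hx) (hm k)]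
    refine measureReal_mono fun x (hx : fisherG x = k) => ⟨?_, ?_⟩
    · exact ht.2.trans_eq hx.symm
    · exact fun h : k < fisherG x => h.ne' hx
  have hlim : Tendsto (fun t => fisherTail (numFreq d) t - fisherTail (numFreq d) k) (𝓝[<] k)
      (𝓝 0) := by
    have := ((continuous_fisherTail (numFreq d)).tendsto k).sub_const (fisherTail (numFreq d) k)
    rw [sub_self] at this
    exact this.mono_left nhdsWithin_le_nhds
  have h0 := ge_of_tendsto hlim (eventually_of_mem (Ioo_mem_nhdsLT hk) hle)
  rw [← measureReal_eq_zero_iff]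
  exact le_antisymm h0 measureReal_nonneg

end Normal

/-! ### Tools for weak convergence and independence. -/

/-- The continuous mapping theorem for a function that is continuous outside a closed null set. -/
lemma tendsto_map_of_continuousOn_compl {E F : Type*} [TopologicalSpace E] [MeasurableSpace E]
    [OpensMeasurableSpace E] [HasOuterApproxClosed E] [TopologicalSpace F] [MeasurableSpace F]
    [BorelSpace F] {ν : ℕ → ProbabilityMeasure E} {ν₀ : ProbabilityMeasure E}
    (hν : Tendsto ν atTop (𝓝 ν₀)) {f : E → F} (hf : Measurable f) {A : Set E} (hA : IsClosed A)
    (hfA : ContinuousOn f Aᶜ) (hnull : (ν₀ : Measure E) A = 0) :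
    Tendsto (fun n => (ν n).map hf.aemeasurable) atTop (𝓝 (ν₀.map hf.aemeasurable)) := by
  refine tendsto_of_forall_isOpen_le_liminf_nat' fun G hG => ?_
  -- The preimage of `G` need not be open, but its part off `A` is, and that part carries all of its
  -- limit mass.
  have hopen : IsOpen (Aᶜ ∩ f ⁻¹' G) := hfA.isOpen_inter_preimage hA.isOpen_compl hG
  simp only [ProbabilityMeasure.toMeasure_map, Measure.map_apply hf hG.measurableSet]
  calc (ν₀ : Measure E) (f ⁻¹' G) = (ν₀ : Measure E) (Aᶜ ∩ f ⁻¹' G) := by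
        rw [Set.inter_comm, ← Set.sdiff_eq, measure_sdiff_null hnull]
    _ ≤ liminf (fun n => (ν n : Measure E) (Aᶜ ∩ f ⁻¹' G)) atTop :=
        ProbabilityMeasure.le_liminf_measure_open_of_tendsto hν hopen
    _ ≤ liminf (fun n => (ν n : Measure E) (f ⁻¹' G)) atTop :=
        liminf_le_liminf (Eventually.of_forall fun n => measure_mono Set.inter_subset_right)

/-- The rows of an independent array are independent. -/
lemma iIndepFun_curry {Ω ι κ β : Type*} {mΩ : MeasurableSpace Ω} {mβ : MeasurableSpace β}
    {P : Measure Ω} {X : ι → κ → Ω → β} (mX : ∀ i k, Measurable (X i k))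
    (h : iIndepFun (fun (p : ι × κ) ω => X p.1 p.2 ω) P) :
    iIndepFun (fun i ω k => X i k ω) P := by
  have := h.isProbabilityMeasure
  have hprob : ∀ i k, IsProbabilityMeasure (P.map (X i k)) :=
    fun i k => Measure.isProbabilityMeasure_map (mX i k).aemeasurable
  have hrow : ∀ i, P.map (fun ω k => X i k ω) = Measure.infinitePi fun k => P.map (X i k) :=
    fun i => (h.precomp (g := fun k => (i, k)) (Prod.mk_right_injective i)).map_fun_eq_infinitePi_map
      (mX i)
  rw [iIndepFun_iff_map_fun_eq_infinitePi_map fun i => measurable_pi_lambda _ (mX i)]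
  simp_rw [hrow]
  have hall := h.map_fun_eq_infinitePi_map fun p : ι × κ => mX p.1 p.2
  rw [← Measure.infinitePi_map_curry, ← hall,
    Measure.map_map (by fun_prop) (measurable_pi_lambda _ fun p : ι × κ => mX p.1 p.2)]
  rfl

lemma map_eq_of_zero_or_one {Ω : Type*} [MeasurableSpace Ω] {μ : Measure Ω}
    [IsProbabilityMeasure μ]
    {U V : Ω → ℝ} (hU : Measurable U) (hV : Measurable V)
    (hU01 : ∀ ω, U ω = 0 ∨ U ω = 1) (hV01 : ∀ ω, V ω = 0 ∨ V ω = 1)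
    (h : μ.real {ω | U ω = 1} = μ.real {ω | V ω = 1}) : μ.map U = μ.map V := by
  have hformula : ∀ {W : Ω → ℝ}, Measurable W → (∀ ω, W ω = 0 ∨ W ω = 1) → ∀ s, MeasurableSet s →
      (μ.map W).real s = s.indicator 1 (1 : ℝ) * μ.real {ω | W ω = 1} +
        s.indicator 1 (0 : ℝ) * (1 - μ.real {ω | W ω = 1}) := by
    intro W hW hW01 s hs
    have hm : MeasurableSet {ω | W ω = 1} := hW (measurableSet_singleton 1)
    rw [map_measureReal_apply hW hs, ← probReal_compl_eq_one_sub hm]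
    by_cases h1 : (1 : ℝ) ∈ s <;> by_cases h0 : (0 : ℝ) ∈ s
    · rw [show W ⁻¹' s = Set.univ from Set.eq_univ_of_forall fun ω => by
        rcases hW01 ω with h | h <;> simp [h, h0, h1]]
      simp [h0, h1, probReal_compl_eq_one_sub hm]
    · rw [show W ⁻¹' s = {ω | W ω = 1} by
        ext ω; rcases hW01 ω with h | h <;> simp [h, h0, h1]]
      simp [h0, h1]
    · rw [show W ⁻¹' s = {ω | W ω = 1}ᶜ by
        ext ω; rcases hW01 ω with h | h <;> simp [h, h0, h1]]
      simp [h0, h1]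
    · rw [show W ⁻¹' s = ∅ by
        ext ω; rcases hW01 ω with h | h <;> simp [h, h0, h1]]
      simp [h0, h1]
  have := Measure.isProbabilityMeasure_map (μ := μ) hU.aemeasurable
  have := Measure.isProbabilityMeasure_map (μ := μ) hV.aemeasurable
  ext s hs
  rw [← ENNReal.toReal_eq_toReal_iff' (measure_ne_top _ _) (measure_ne_top _ _)]
  change (μ.map U).real s = (μ.map V).real s
  rw [hformula hU hU01 s hs, hformula hV hV01 s hs, h]

lemma eq_indicator_of_zero_or_one {Ω : Type*} {U : Ω → ℝ} (hU01 : ∀ ω, U ω = 0 ∨ U ω = 1) :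
    U = {ω | U ω = 1}.indicator 1 := by
  ext ω
  rcases hU01 ω with h | h <;> simp [Set.indicator, h]

lemma integral_of_zero_or_one {Ω : Type*} [MeasurableSpace Ω] {μ : Measure Ω}
    [IsProbabilityMeasure μ]
    {U : Ω → ℝ} (hU : Measurable U) (hU01 : ∀ ω, U ω = 0 ∨ U ω = 1) :
    Integrable U μ ∧ ∫ ω, U ω ∂μ = μ.real {ω | U ω = 1} := by
  have hm : MeasurableSet {ω | U ω = 1} := hU (measurableSet_singleton 1)
  constructor
  · rw [eq_indicator_of_zero_or_one hU01]
    exact (integrable_const 1).indicator hm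
  · conv_lhs => rw [eq_indicator_of_zero_or_one hU01]
    rw [integral_indicator_one hm]

/-! ### Central limit theorem for the block sums. -/

/-- The standardized Bernoulli variable. -/
noncomputable def standardize (p u : ℝ) : ℝ := (u - p) / √(p * (1 - p))

lemma measurable_standardize (p : ℝ) : Measurable (standardize p) := by
  unfold standardize; fun_prop

lemma integral_standardize {Ω : Type*} [MeasurableSpace Ω] {μ : Measure Ω}
    [IsProbabilityMeasure μ]
    {U : Ω → ℝ} (hU : Measurable U) (hU01 : ∀ ω, U ω = 0 ∨ U ω = 1)
    {p : ℝ} (hp : μ.real {ω | U ω = 1} = p) : ∫ ω, standardize p (U ω) ∂μ = 0 := by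
  obtain ⟨hi, hE⟩ := integral_of_zero_or_one (μ := μ) hU hU01
  unfold standardize
  rw [integral_div, integral_sub hi (integrable_const _), hE, hp]
  simp

lemma integral_standardize_sq {Ω : Type*} [MeasurableSpace Ω] {μ : Measure Ω}
    [IsProbabilityMeasure μ]
    {U : Ω → ℝ} (hU : Measurable U) (hU01 : ∀ ω, U ω = 0 ∨ U ω = 1)
    {p : ℝ} (hp0 : 0 < p) (hp1 : p < 1) (hp : μ.real {ω | U ω = 1} = p) :
    ∫ ω, standardize p (U ω) ^ 2 ∂μ = 1 := by
  obtain ⟨hi, hE⟩ := integral_of_zero_or_one (μ := μ) hU hU01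
  have hpos : 0 < p * (1 - p) := mul_pos hp0 (by linarith)
  -- As `U ^ 2 = U`, the square is affine in `U`.
  have h : ∀ ω, standardize p (U ω) ^ 2 = (U ω * (1 - 2 * p) + p ^ 2) / (p * (1 - p)) := by
    intro ω
    rw [standardize, div_pow, Real.sq_sqrt hpos.le]
    congr 1
    rcases hU01 ω with h | h <;> rw [h] <;> ring
  simp_rw [h]
  rw [integral_div, integral_add (hi.mul_const _) (integrable_const _), integral_mul_const, hE, hp]
  simp only [integral_const, probReal_univ, one_smul]
  rw [div_eq_one_iff_eq hpos.ne']
  ring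

/-- The standardized block sums. -/
noncomputable def blockSum {Ω : Type*} (Y : ℕ → Ω → ℝ) (p : ℝ) (d m : ℕ) (ω : Ω) (i : Fin d) : ℝ :=
  (√m)⁻¹ * ∑ k ∈ Finset.range m, standardize p (Y (i + k * d) ω)

lemma measurable_blockSum {Ω : Type*} [MeasurableSpace Ω] {Y : ℕ → Ω → ℝ}
    (hYm : ∀ ℓ, Measurable (Y ℓ)) (p : ℝ) (d m : ℕ)
    (i : Fin d) : Measurable fun ω => blockSum Y p d m ω i :=
  (Finset.measurable_sum _ fun _ _ => (measurable_standardize p).comp (hYm _)).const_mul _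

/-- Remainder and quotient mod `d` recover the pair, so no observation is used twice; independence
within and across residue classes follows. -/
lemma injective_blockIndex (d : ℕ) :
    Function.Injective fun q : Fin d × ℕ => (q.1 : ℕ) + q.2 * d := by
  rintro ⟨i, k⟩ ⟨i', k'⟩ h
  simp only at h
  have h1 := congrArg (· % d) h
  simp only [Nat.add_mul_mod_self_right, Nat.mod_eq_of_lt i.2, Nat.mod_eq_of_lt i'.2] at h1
  have hpos : 0 < d := i.pos
  rw [h1] at h
  have h2 : k = k' := Nat.eq_of_mul_eq_mul_right hpos (by omega)
  exact Prod.ext (Fin.ext h1) h2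

lemma iIndepFun_blockSum {Ω : Type*} [MeasurableSpace Ω] {μ : Measure Ω}
    {Y : ℕ → Ω → ℝ} (hYm : ∀ ℓ, Measurable (Y ℓ)) (hYind : iIndepFun Y μ)
    (p : ℝ) (d m : ℕ) : iIndepFun (fun (i : Fin d) ω => blockSum Y p d m ω i) μ := by
  have h1 := iIndepFun_curry (X := fun (i : Fin d) (k : ℕ) => Y (i + k * d)) (fun i k => hYm _)
    (hYind.precomp (injective_blockIndex d))
  exact h1.comp (fun _ (y : ℕ → ℝ) => (√m)⁻¹ * ∑ k ∈ Finset.range m, standardize p (y k))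
    fun _ => (Finset.measurable_sum _ fun k _ =>
      (measurable_standardize p).comp (measurable_pi_apply k)).const_mul _

/-- With `m = n / d`, the block mean is `p + √(p (1 - p)) / √m` times the block sum. -/
lemma fisherF_blockMean {Ω : Type*} {p : ℝ} (hp0 : 0 < p) (hp1 : p < 1) (Y : ℕ → Ω → ℝ)
    (d n : ℕ) (ω : Ω) :
    fisherF (blockMean Y d n ω) = fisherF (blockSum Y p d (n / d) ω) := by
  have hσ : 0 < √(p * (1 - p)) := Real.sqrt_pos.2 (mul_pos hp0 (by linarith))
  rcases Nat.eq_zero_or_pos (n / d) with h | h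
  -- For empty blocks both series are zero, by `1 / 0 = 0` and the empty sum.
  · congr 1
    ext i
    simp [blockMean, blockSum, h]
  · have hm : (0 : ℝ) < (n / d : ℕ) := by exact_mod_cast h
    have hsm : 0 < √((n / d : ℕ) : ℝ) := Real.sqrt_pos.2 hm
    rw [← fisherF_affine (c := √(p * (1 - p)) / √((n / d : ℕ) : ℝ)) (by positivity) p
      (blockSum Y p d (n / d) ω)]
    congr 1
    ext i
    simp only [blockMean, blockSum, standardize]
    rw [← Finset.sum_div, Finset.sum_sub_distrib, Finset.sum_const, Finset.card_range, nsmul_eq_mul]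
    set m : ℝ := ((n / d : ℕ) : ℝ)
    set S := ∑ k ∈ Finset.range (n / d), Y (i + k * d) ω
    have hmm : √m * √m = m := Real.mul_self_sqrt hm.le
    have : √(p * (1 - p)) / √m * ((√m)⁻¹ * ((S - m * p) / √(p * (1 - p)))) =
        (S - m * p) / (√m * √m) := by
      field_simp
    rw [this, hmm]
    field_simp
    ring

/-- The central limit theorem for the vector of standardized block sums. -/
lemma tendsto_map_blockSum {Ω : Type*} [MeasurableSpace Ω] {μ : Measure Ω}
    [IsProbabilityMeasure μ]
    {Y : ℕ → Ω → ℝ} (hYm : ∀ ℓ, Measurable (Y ℓ))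
    (hY01 : ∀ ℓ ω, Y ℓ ω = 0 ∨ Y ℓ ω = 1) (hYind : iIndepFun Y μ)
    {p : ℝ} (hp0 : 0 < p) (hp1 : p < 1) (hYp : ∀ ℓ, μ.real {ω | Y ℓ ω = 1} = p) (d : ℕ) :
    Tendsto (β := ProbabilityMeasure (Fin d → ℝ))
      (fun m : ℕ => ⟨μ.map fun ω => blockSum Y p d m ω, Measure.isProbabilityMeasure_map
        (measurable_pi_lambda _ fun i => measurable_blockSum hYm p d m i).aemeasurable⟩)
      atTop (𝓝 ⟨stdNormal d, inferInstance⟩) := by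
  have hone : ∀ i : Fin d, TendstoInDistribution (fun (m : ℕ) ω => blockSum Y p d m ω i) atTop
      (id : ℝ → ℝ) (fun _ => μ) (gaussianReal 0 1) := by
    intro i
    have hident : ∀ k : ℕ, IdentDistrib (fun ω => standardize p (Y (i + k * d) ω))
        (fun ω => standardize p (Y (i + 0 * d) ω)) μ μ := fun k =>
      IdentDistrib.comp ⟨(hYm _).aemeasurable, (hYm _).aemeasurable,
        map_eq_of_zero_or_one (hYm _) (hYm _) (hY01 _) (hY01 _) (by rw [hYp, hYp])⟩
        (measurable_standardize p)
    have hind : iIndepFun (fun (k : ℕ) ω => standardize p (Y (i + k * d) ω)) μ :=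
      (hYind.precomp ((injective_blockIndex d).comp (Prod.mk_right_injective i))).comp
        (fun _ => standardize p) (fun _ => measurable_standardize p)
    exact tendstoInDistribution_inv_sqrt_mul_sum (X := fun k ω => standardize p (Y (i + k * d) ω))
      HasLaw.id (integral_standardize (hYm _) (hY01 _) (hYp _))
      (integral_standardize_sq (hYm _) (hY01 _) hp0 hp1 (hYp _)) hind hident
  -- Product measures depend continuously on their factors, so coordinatewise convergence of
  -- independent coordinates is joint convergence.
  have hpi := (ProbabilityMeasure.continuous_pi (ι := Fin d) (α := fun _ => ℝ)).tendsto
    (fun i => ⟨(gaussianReal 0 1).map id, Measure.isProbabilityMeasure_map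
      (hone i).aemeasurable_limit⟩)
  have hcomp := hpi.comp (tendsto_pi_nhds.2 fun i => (hone i).tendsto)
  simp only [Measure.map_id] at hcomp
  exact hcomp.congr fun m => Subtype.ext ((iIndepFun_iff_map_fun_eq_pi_map fun i =>
    (measurable_blockSum hYm p d m i).aemeasurable).1 (iIndepFun_blockSum hYm hYind p d m)).symm

/-- Fisher's statistic of the block means converges weakly to the one of a normal vector. -/
lemma tendsto_map_fisherF_blockMean {Ω : Type*} [MeasurableSpace Ω] {μ : Measure Ω}
    [IsProbabilityMeasure μ]
    {Y : ℕ → Ω → ℝ} (hYm : ∀ ℓ, Measurable (Y ℓ))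
    (hY01 : ∀ ℓ ω, Y ℓ ω = 0 ∨ Y ℓ ω = 1) (hYind : iIndepFun Y μ)
    {p : ℝ} (hp0 : 0 < p) (hp1 : p < 1) (hYp : ∀ ℓ, μ.real {ω | Y ℓ ω = 1} = p)
    {d : ℕ} (hd : 3 ≤ d) {Ω' : Type*} [MeasurableSpace Ω'] {μ' : Measure Ω'}
    [IsProbabilityMeasure μ'] {N : Fin d → Ω' → ℝ} (hNind : iIndepFun N μ')
    (hN : ∀ i, HasLaw (N i) (gaussianReal 0 1) μ') :
    (∀ᵐ ω' ∂μ', (fun i => N i ω') ∉ degenerateSet d) ∧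
    TendstoInDistribution (fun n ω => fisherF (blockMean Y d n ω)) atTop
      (fun ω' => fisherG (fun i => N i ω')) (fun _ => μ) μ' := by
  have hNm : AEMeasurable (fun ω' i => N i ω') μ' :=
    aemeasurable_pi_iff.2 fun i => (hN i).aemeasurable
  have hNlaw : μ'.map (fun ω' i => N i ω') = stdNormal d := by
    rw [(iIndepFun_iff_map_fun_eq_pi_map fun i => (hN i).aemeasurable).1 hNind]
    simp_rw [(hN _).map_eq]
  have hnot : ∀ᵐ ω' ∂μ', (fun i => N i ω') ∉ degenerateSet d := by
    have := ae_notMem_degenerateSet hd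
    rw [← hNlaw] at this
    exact ae_of_ae_map hNm this
  have hWm : ∀ m, Measurable fun ω => blockSum Y p d m ω := fun m =>
    measurable_pi_lambda _ fun i => measurable_blockSum hYm p d m i
  simp_rw [fun n ω => fisherF_blockMean (Ω := Ω) hp0 hp1 Y d n ω]
  refine ⟨hnot, fun n => ((measurable_fisherF hd).comp (hWm _)).aemeasurable,
    (measurable_fisherG hd).comp_aemeasurable hNm, ?_⟩
  have hlim := tendsto_map_of_continuousOn_compl
    ((tendsto_map_blockSum hYm hY01 hYind hp0 hp1 hYp d).comp
      (Nat.tendsto_div_const_atTop (by omega : d ≠ 0))) (measurable_fisherF hd)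
    (isClosed_degenerateSet d) (continuousOn_fisherF hd)
    (measure_eq_zero_iff_ae_notMem.2 (ae_notMem_degenerateSet hd))
  have hmap : μ'.map (fun ω' => fisherG fun i => N i ω') = (stdNormal d).map fisherF := by
    rw [← hNlaw, AEMeasurable.map_map_of_aemeasurable (measurable_fisherF hd).aemeasurable hNm]
    refine Measure.map_congr ?_
    filter_upwards [hnot] with ω' hω'
    exact (fisherF_of_notMem hω').symm
  simp only [hmap]
  exact hlim.congr fun n => Subtype.ext (Measure.map_map (measurable_fisherF hd) (hWm _))

end BinaryPeriodicity

/-! ### The main theorem. -/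

theorem mainTheorem1 {Ω : Type*} [MeasurableSpace Ω] (μ : Measure Ω)
    [IsProbabilityMeasure μ] (Y : ℕ → Ω → ℝ) (hYm : ∀ ℓ, Measurable (Y ℓ))
    (hY01 : ∀ ℓ ω, Y ℓ ω = 0 ∨ Y ℓ ω = 1) (hYind : iIndepFun Y μ)
    (p : ℝ) (hp0 : 0 < p) (hp1 : p < 1) (hYp : ∀ ℓ, μ.real {ω | Y ℓ ω = 1} = p)
    (d : ℕ) (hd : 3 ≤ d) :
    (∀ {Ω' : Type*} [MeasurableSpace Ω'] (μ' : Measure Ω') [IsProbabilityMeasure μ']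
        (N : Fin d → Ω' → ℝ), iIndepFun N μ' → (∀ i, HasLaw (N i) (gaussianReal 0 1) μ') →
        (∀ᵐ ω' ∂μ', (fun i => N i ω') ∉ BinaryPeriodicity.degenerateSet d) ∧
        TendstoInDistribution
          (fun n ω => BinaryPeriodicity.fisherF (BinaryPeriodicity.blockMean Y d n ω)) atTop
          (fun ω' => BinaryPeriodicity.fisherG (fun i => N i ω')) (fun _ => μ) μ') ∧
    (∀ α : ℝ, 0 < α → α < 1 →
        (5 ≤ d → ∃! k : ℝ, BinaryPeriodicity.fisherTail (BinaryPeriodicity.numFreq d) k = α) ∧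
        ∀ k : ℝ, BinaryPeriodicity.fisherTail (BinaryPeriodicity.numFreq d) k = α →
          Tendsto (fun n : ℕ =>
              μ.real {ω | k < BinaryPeriodicity.fisherF (BinaryPeriodicity.blockMean Y d n ω)})
            atTop (𝓝 α)) := by
  refine ⟨fun {Ω'} _ μ' _ N hNind hN => BinaryPeriodicity.tendsto_map_fisherF_blockMean hYm hY01
    hYind hp0 hp1 hYp hd hNind hN, fun α h0 h1 => ⟨fun h5 =>
      BinaryPeriodicity.existsUnique_fisherTail_eq (by rw [BinaryPeriodicity.numFreq]; omega) h0 h1,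
      fun k hk => ?_⟩⟩
  -- For `d = 3, 4` the tail is constantly `1`, so the equation has no solution with `α < 1`.
  have h5 : 5 ≤ d := by
    by_contra h
    have hq : BinaryPeriodicity.numFreq d = 1 := by rw [BinaryPeriodicity.numFreq]; omega
    rw [hq, BinaryPeriodicity.fisherTail_one] at hk
    linarith
  have hq : 2 ≤ BinaryPeriodicity.numFreq d := by rw [BinaryPeriodicity.numFreq]; omega
  have hkpos : 0 < k :=
    lt_of_le_of_lt (by positivity) (BinaryPeriodicity.mem_Ioo_of_fisherTail_eq hq h0 h1 hk).1
  have hG := BinaryPeriodicity.measurable_fisherG hd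
  have hconv := (BinaryPeriodicity.tendsto_map_fisherF_blockMean hYm hY01 hYind hp0 hp1 hYp hd
    BinaryPeriodicity.iIndepFun_eval_stdNormal BinaryPeriodicity.hasLaw_eval_stdNormal).2
  -- The frontier of `(k, ∞)` is `{k}`, which the limit law does not charge.
  have hlim := ProbabilityMeasure.tendsto_measure_of_null_frontier_of_tendsto' hconv.tendsto
    (E := Set.Ioi k) (by
      rw [frontier_Ioi]
      change (BinaryPeriodicity.stdNormal d).map BinaryPeriodicity.fisherG {k} = 0
      rw [Measure.map_apply hG (measurableSet_singleton k)]
      exact BinaryPeriodicity.stdNormal_fisherG_eq h5 hkpos)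
  have hreal := (ENNReal.tendsto_toReal
    (a := (BinaryPeriodicity.stdNormal d).map BinaryPeriodicity.fisherG (Set.Ioi k))
    (measure_ne_top _ _)).comp hlim
  rw [Measure.map_apply hG measurableSet_Ioi] at hreal
  rw [← hk, ← BinaryPeriodicity.measureReal_lt_fisherG h5 hkpos.le]
  exact hreal.congr fun n => congrArg ENNReal.toReal
    (Measure.map_apply_of_aemeasurable (hconv.forall_aemeasurable n) measurableSet_Ioi)
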